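/- Let $A,H\in\mathbb R^{n\times n}$, $C\in\mathbb R^{p\times n}$, $L,\bar L\in\mathbb R^{N\times N}$ (for instance the weight matrices of a directed weighted network on $N$ nodes before and after a change of topology), and $\Delta=\mathrm{diag}(\delta_1,\dots,\delta_N)$ with $\delta_i\in\{0,1\}$. Put $$\Phi=I_N\otimes A+L\otimes H,\qquad \bar\Phi=I_N\otimes A+\bar L\otimes H,\qquad \Psi=\Delta\otimes C .$$ The change $L\to\bar L$ is called $\Psi$-discernible if the only pair $(X_0,\bar X_0)\in\mathbb R^{Nn}\times\mathbb R^{Nn}$ with $\Psi e^{\Phi t}X_0=\Psi e^{\bar\Phi t}\bar X_0$ for all $t\ge 0$ is $(0,0)$. Below, $S(\mu|M)\subseteq\mathbb C^m$ denotes the complex eigenspace of an $m\times m$ matrix $M$ for $\mu\in\mathbb C$ (which is $\{0\}$ if $\mu$ is not an eigenvalue), $\sigma(M)$ the set of all complex eigenvalues of $M$, and $\mathcal N(\cdot)$ the complex null space. *Jordan chains of $L$.* Let $\lambda_1,\dots,\lambda_s$ be the eigenvalues of $L$, listed with geometric multiplicity, with Jordan chains $t_i^1,\dots,t_i^{\alpha_i}$,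 that is, $\alpha_i\ge 1$, $Lt_i^1=\lambda_it_i^1$ and $Lt_i^{k+1}=\lambda_it_i^{k+1}+t_i^{k}$ for $1\le k<\alpha_i$, such that the vectors $t_i^k$ ($1\le i\le s$, $1\le k\le\alpha_i$) form a basis of $\mathbb C^N$. *Generalized Jordan chains.* A generalized Jordan chain of $M\in\mathbb C^{n\times n}$ about $H$ for $\mu$, of length $\theta\in\{1,2,\dots\}\cup\{\infty\}$, is a sequence $x^1,x^2,\dots$ of $\theta$ vectors in $\mathbb C^n$ with $x^1\ne0$, $(\mu I-M)x^1=0$ and $(\mu I-M)x^{k+1}=Hx^k$ for $1\le k<\theta$; $x^1$ is its top vector. For each $i$ let $\mu_i^1,\dots,\mu_i^{p_i}$ be the eigenvalues of $A+\lambda_iH$, listed with geometric multiplicity, with generalized Jordan chains $\xi_{ij}^1,\xi_{ij}^2,\dots$ of $A+\lambda_iH$ about $H$ for $\mu_i^j$, of length $\theta_{ij}$, chosen with linearly independent top vectors and of maximal lengths in the following sense: for all $\mu\in\mathbb C$ and all $k\ge1$, the top vector of every generalized Jordan chain of $A+\lambda_iH$ about $H$ for $\mu$ of length $k$ is a linear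 combination of the $\xi_{ij}^1$ with $\mu_i^j=\mu$ and $\theta_{ij}\ge k$. (In particular, the $\xi_{ij}^1$ with $\mu_i^j=\mu$ form a basis of $S(\mu|A+\lambda_iH)$.) *The spaces $V_{ij}$.* Put $\gamma_{ij}=\min\{\alpha_i,\theta_{ij}\}$, $\eta_{ij}^m=\sum_{k=1}^{m}t_i^{m+1-k}\otimes\xi_{ij}^{k}$, $V_{ij}=\mathrm{span}_{\mathbb C}\{\eta_{ij}^1,\dots,\eta_{ij}^{\gamma_{ij}}\}$ and $\Gamma(\mu)=\{(i,j):1\le i\le s,\ 1\le j\le p_i,\ \mu_i^j=\mu\}$. Define $\bar V_{ij}$ and $\bar\Gamma(\mu)$ in the same way with $\bar L$ in place of $L$. **Theorem.** For every $\mu\in\mathbb C$ the sums $\sum_{(i,j)\in\Gamma(\mu)}V_{ij}$ and $\sum_{(i,j)\in\bar\Gamma(\mu)}\bar V_{ij}$ are direct, and $$S(\mu|\Phi)=\bigoplus_{(i,j)\in\Gamma(\mu)}V_{ij},\qquad S(\mu|\bar\Phi)=\bigoplus_{(i,j)\in\bar\Gamma(\mu)}\bar V_{ij}.$$ Moreover,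 $L\to\bar L$ is $\Psi$-discernible if and only if for all $\mu\in\sigma(\Phi)\cup\sigma(\bar\Phi)$ both of the following hold: 1. $\Big(\bigoplus_{(i,j)\in\Gamma(\mu)}V_{ij}\Big)\cap\Big(\bigoplus_{(i,j)\in\bar\Gamma(\mu)}\bar V_{ij}\Big)=\{0\}$; 2. $\mathcal N(\Delta\otimes C)\cap\Big(\bigoplus_{(i,j)\in\Gamma(\mu)}V_{ij}+\bigoplus_{(i,j)\in\bar\Gamma(\mu)}\bar V_{ij}\Big)=\{0\}$ (by 1., the sum is direct). -/

import Mathlib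

open scoped Matrix Kronecker

namespace NetworkedLTI

/-- The complex matrix with the same entries as the real matrix `M`. -/
noncomputable def toC {ι κ : Type*} (M : Matrix ι κ ℝ) : Matrix ι κ ℂ :=
  M.map (fun r : ℝ => (r : ℂ))

/-! ### The networked system -/

/-- State matrix `Φ = I_N ⊗ A + L ⊗ H` of the whole network. -/
def stateMatrix {N n : ℕ} (A H : Matrix (Fin n) (Fin n) ℝ) (L : Matrix (Fin N) (Fin N) ℝ) :
    Matrix (Fin N × Fin n) (Fin N × Fin n) ℝ :=
  (1 : Matrix (Fin N) (Fin N) ℝ) ⊗ₖ A + L ⊗ₖ H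

/-- Sensor location matrix `Δ = diag(δ_1, …, δ_N)`: `δ_i = 1` if node `i` is measured
(that is, `i ∈ S`), and `δ_i = 0` otherwise. -/
def sensorMatrix {N : ℕ} (S : Finset (Fin N)) : Matrix (Fin N) (Fin N) ℝ :=
  Matrix.diagonal (fun i => if i ∈ S then 1 else 0)

/-- Output matrix `Ψ = Δ ⊗ C` of the whole network. -/
def outputMatrix {N n p : ℕ} (S : Finset (Fin N)) (C : Matrix (Fin p) (Fin n) ℝ) :
    Matrix (Fin N × Fin p) (Fin N × Fin n) ℝ :=
  sensorMatrix S ⊗ₖ C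

/-- `(X, X')` is a `Ψ`-indiscernible pair of initial states: the trajectories of `Φ` from `X` and
of `Φ'` from `X'` have the same output for all `t ≥ 0`. -/
def IsIndiscerniblePair {ι κ : Type*} [Fintype ι] [DecidableEq ι]
    (Φ Φ' : Matrix ι ι ℝ) (Ψ : Matrix κ ι ℝ) (X X' : ι → ℝ) : Prop :=
  ∀ t : ℝ, 0 ≤ t →
    Ψ *ᵥ (NormedSpace.exp (t • Φ) *ᵥ X) = Ψ *ᵥ (NormedSpace.exp (t • Φ') *ᵥ X')

/-- The change `Φ → Φ'` is `Ψ`-discernible: the only `Ψ`-indiscernible pair is `(0, 0)`. -/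
def IsDiscernible {ι κ : Type*} [Fintype ι] [DecidableEq ι]
    (Φ Φ' : Matrix ι ι ℝ) (Ψ : Matrix κ ι ℝ) : Prop :=
  ∀ X X' : ι → ℝ, IsIndiscerniblePair Φ Φ' Ψ X X' → X = 0 ∧ X' = 0

/-- The set `σ(M)` of all eigenvalues of a complex square matrix. -/
def eigenvalues {ι : Type*} [Fintype ι] [DecidableEq ι] (M : Matrix ι ι ℂ) : Set ℂ :=
  {μ | Module.End.HasEigenvalue (Matrix.toLin' M) μ}

/-- The eigenspace `S(μ|M)`; it is `0` if `μ` is not an eigenvalue of `M`. -/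
noncomputable def eigenspace {ι : Type*} [Fintype ι] [DecidableEq ι] (M : Matrix ι ι ℂ) (μ : ℂ) :
    Submodule ℂ (ι → ℂ) :=
  Module.End.eigenspace (Matrix.toLin' M) μ

/-- The complex null space of a matrix. -/
noncomputable def nullSpace {ι κ : Type*} [Fintype ι] (M : Matrix κ ι ℂ) :
    Submodule ℂ (ι → ℂ) :=
  LinearMap.ker M.mulVecLin

/-! ### Jordan chains. All chains are indexed from `0`. -/

/-- The Jordan chains of a complex square matrix `M` (one for each Jordan block, so that an
eigenvalue is listed as often as its geometric multiplicity): chains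
`t i 0, …, t i (α i - 1)` with top (eigen)vector `t i 0`, which together form a basis.
The values `t i k` with `k ≥ α i` play no role. -/
structure JordanChains {N : ℕ} (M : Matrix (Fin N) (Fin N) ℂ) where
  /-- number of chains -/
  s : ℕ
  /-- eigenvalue of each chain -/
  eigval : Fin s → ℂ
  /-- length of each chain -/
  α : Fin s → ℕ
  /-- the vectors of the chains -/
  t : Fin s → ℕ → (Fin N → ℂ)
  one_le_α : ∀ i, 1 ≤ α i
  top_vec : ∀ i, M *ᵥ t i 0 = eigval i • t i 0
  succ_vec : ∀ i k, k + 1 < α i → M *ᵥ t i (k + 1) = eigval i • t i (k + 1) + t i k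
  linearIndependent : LinearIndependent ℂ (fun q : (Σ i : Fin s, Fin (α i)) => t q.1 q.2)
  span_eq_top : Submodule.span ℂ (Set.range fun q : (Σ i : Fin s, Fin (α i)) => t q.1 q.2) = ⊤

/-- `x 0, x 1, …` (the `θ` vectors with index `< θ`) is a generalized Jordan chain of `M` about `H`
corresponding to the eigenvalue `μ`, with top vector `x 0 ≠ 0`. Infinite chains (`θ = ⊤`) are
allowed: they can occur when `H` is singular, for instance when `H = 0`. -/
structure IsGenJordanChain {n : ℕ} (M H : Matrix (Fin n) (Fin n) ℂ) (μ : ℂ) (θ : ℕ∞)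
    (x : ℕ → (Fin n → ℂ)) : Prop where
  one_le : 1 ≤ θ
  top_ne_zero : x 0 ≠ 0
  top_vec : (μ • (1 : Matrix (Fin n) (Fin n) ℂ) - M) *ᵥ x 0 = 0
  succ_vec : ∀ k : ℕ, ((k + 1 : ℕ) : ℕ∞) < θ →
    (μ • (1 : Matrix (Fin n) (Fin n) ℂ) - M) *ᵥ x (k + 1) = H *ᵥ x k

/-- The generalized Jordan chains of `M` about `H` (one for each eigenvalue of `M`, counted with
geometric multiplicity): the top vectors are linearly independent, and the lengths are maximal, in
the sense that the top vector of any chain of length `k` for the eigenvalue `μ` is a combination of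
the top vectors of those listed chains for `μ` that have length at least `k`. (With `k = 1`: the
top vectors for `μ` form a basis of the eigenspace of `μ`. Also, no chain with top vector `ξ j 0`
is longer than `θ j`. For `H = 1` these are the chains of a Jordan basis, up to signs.) -/
structure GenJordanChains {n : ℕ} (M H : Matrix (Fin n) (Fin n) ℂ) where
  /-- number of chains -/
  p : ℕ
  /-- eigenvalue of each chain -/
  eigval : Fin p → ℂ
  /-- length of each chain -/
  θ : Fin p → ℕ∞
  /-- the vectors of the chains -/
  ξ : Fin p → ℕ → (Fin n → ℂ)
  isChain : ∀ j, IsGenJordanChain M H (eigval j) (θ j) (ξ j)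
  linearIndependent : LinearIndependent ℂ (fun j => ξ j 0)
  maximal : ∀ (μ : ℂ) (k : ℕ) (x : ℕ → (Fin n → ℂ)), IsGenJordanChain M H μ (k : ℕ∞) x →
    x 0 ∈ Submodule.span ℂ {v | ∃ j, eigval j = μ ∧ (k : ℕ∞) ≤ θ j ∧ v = ξ j 0}

/-- Kronecker product of two vectors. -/
def kronVec {N n : ℕ} (u : Fin N → ℂ) (v : Fin n → ℂ) : Fin N × Fin n → ℂ :=
  fun q => u q.1 * v q.2

/-- `η^{m+1} = t^{m+1} ⊗ ξ^1 + t^m ⊗ ξ^2 + ⋯ + t^1 ⊗ ξ^{m+1}` (here `t`, `ξ` are indexed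
from `0`). -/
def eta {N n : ℕ} (t : ℕ → (Fin N → ℂ)) (ξ : ℕ → (Fin n → ℂ)) (m : ℕ) : Fin N × Fin n → ℂ :=
  ∑ k ∈ Finset.range (m + 1), kronVec (t (m - k)) (ξ k)

section Spaces

variable {N n : ℕ} {A H : Matrix (Fin n) (Fin n) ℝ} {L : Matrix (Fin N) (Fin N) ℝ}

/-- The space `V_ij`, spanned by `η_ij^1, …, η_ij^γ` with `γ = min (α_i, θ_ij)`. -/
def V (J : JordanChains (toC L))
    (G : ∀ i : Fin J.s, GenJordanChains (toC A + J.eigval i • toC H) (toC H))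
    (q : Σ i : Fin J.s, Fin (G i).p) : Submodule ℂ (Fin N × Fin n → ℂ) :=
  Submodule.span ℂ {v | ∃ m : ℕ, (m : ℕ∞) < min (J.α q.1 : ℕ∞) ((G q.1).θ q.2) ∧
    v = eta (J.t q.1) ((G q.1).ξ q.2) m}

/-- The index set `Γ(μ)` of the pairs `(i, j)` with `μ_i^j = μ`. -/
def Gam (J : JordanChains (toC L))
    (G : ∀ i : Fin J.s, GenJordanChains (toC A + J.eigval i • toC H) (toC H))
    (μ : ℂ) : Set (Σ i : Fin J.s, Fin (G i).p) :=
  {q | (G q.1).eigval q.2 = μ}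

/-- The sum of the spaces `V_ij` over `(i, j) ∈ Γ(μ)`. -/
def sumV (J : JordanChains (toC L))
    (G : ∀ i : Fin J.s, GenJordanChains (toC A + J.eigval i • toC H) (toC H))
    (μ : ℂ) : Submodule ℂ (Fin N × Fin n → ℂ) :=
  ⨆ q : Gam J G μ, V J G q.1

end Spaces

end NetworkedLTI

/-! Expand a vector of `ℂ^N ⊗ ℂ^n` as `∑ t_i^k ⊗ x_i^k` in the Jordan basis of `L`. Since `L` lowers
`t_i^{k+1}` to `t_i^k`, the vector lies in `S(μ|Φ)` exactly when `(μ - A - λ_i H) x_i^k = H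
x_i^{k+1}` for all `i, k`, with `x_i` zero beyond the Jordan chain (`kronSum_mem_eigenspace_iff`).
Read backwards from its last nonzero term, each `x_i` is thus a generalized Jordan chain, and
maximality of the listed chains allows peeling off its terms one by one (`sum_kronVec_mem_sumV`).
Directness holds because the `η_ij^m` are triangular in the Jordan basis, with the independent top
vectors on the diagonal (`linearIndependent_eta`).

For the criterion, equal outputs mean equal derivatives of all orders at `0`
(`isIndiscerniblePair_iff_pow`). The complex pairs with this property form a subspace invariant
under `Φ × Φ̄`; if nonzero, it contains an eigenvector `(x, x')` with one common `μ`
(`unobservable_eq_bot`). Excluding such pairs, for which `Ψ x = Ψ x'`, amounts to conditions 1 and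
2. -/

namespace NetworkedLTI

/-! ### Kronecker products of vectors -/

section KronVec

variable {N n : ℕ}

/-- `kronVec u` as a linear map. -/
def kronVecLin (u : Fin N → ℂ) : (Fin n → ℂ) →ₗ[ℂ] (Fin N × Fin n → ℂ) where
  toFun := kronVec u
  map_add' v w := by ext q; simp [kronVec, mul_add]
  map_smul' c v := by ext q; simp [kronVec]; ring

lemma kronVec_eq_kronVecLin (u : Fin N → ℂ) (v : Fin n → ℂ) : kronVec u v = kronVecLin u v := rfl

lemma kronVec_add_left (u w : Fin N → ℂ) (v : Fin n → ℂ) :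
    kronVec (u + w) v = kronVec u v + kronVec w v := by
  ext q; simp [kronVec, add_mul]

lemma kronVec_smul_left (c : ℂ) (u : Fin N → ℂ) (v : Fin n → ℂ) :
    kronVec (c • u) v = kronVec u (c • v) := by
  ext q; simp [kronVec]; ring

lemma kronecker_mulVec_kronVec (P : Matrix (Fin N) (Fin N) ℂ) (Q : Matrix (Fin n) (Fin n) ℂ)
    (u : Fin N → ℂ) (v : Fin n → ℂ) :
    (P ⊗ₖ Q) *ᵥ kronVec u v = kronVec (P *ᵥ u) (Q *ᵥ v) := by
  ext ⟨r, a⟩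
  simp only [Matrix.mulVec, dotProduct, kronVec, Matrix.kroneckerMap_apply, Fintype.sum_prod_type,
    Finset.sum_mul_sum]
  exact Finset.sum_congr rfl fun _ _ => Finset.sum_congr rfl fun _ _ => by ring

end KronVec

/-! ### Expansion in the Jordan basis and the eigenvector equation -/

section KronSum

variable {N n : ℕ} {M : Matrix (Fin N) (Fin N) ℂ}

/-- The basis of `ℂ^N` made of the vectors of the Jordan chains. -/
noncomputable def JordanChains.basis (J : JordanChains M) :
    Module.Basis (Σ i : Fin J.s, Fin (J.α i)) ℂ (Fin N → ℂ) :=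
  Module.Basis.mk J.linearIndependent J.span_eq_top.ge

/-- `∑ t_i^k ⊗ x_i^k` over all vectors `t_i^k` of the Jordan chains. -/
noncomputable def kronSum (J : JordanChains M) (x : Fin J.s → ℕ → Fin n → ℂ) :
    Fin N × Fin n → ℂ :=
  ∑ i, ∑ k ∈ Finset.range (J.α i), kronVec (J.t i k) (x i k)

/-- Fixing the `ℂ^n`-coordinate reduces existence and uniqueness of the coefficients `x_i^k` to the
Jordan basis of `ℂ^N`. -/
lemma kronSum_column (J : JordanChains M) (x : Fin J.s → ℕ → Fin n → ℂ) (a : Fin n) :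
    (fun r => kronSum J x (r, a)) =
      ∑ q : (Σ i : Fin J.s, Fin (J.α i)), x q.1 q.2 a • J.basis q := by
  ext r
  simp only [kronSum, Finset.sum_apply, kronVec, JordanChains.basis, Module.Basis.coe_mk,
    Fintype.sum_sigma, Pi.smul_apply, smul_eq_mul]
  refine Finset.sum_congr rfl fun i _ => ?_
  rw [Finset.sum_range]
  exact Finset.sum_congr rfl fun _ _ => mul_comm _ _

lemma kronSum_inj (J : JordanChains M) {x y : Fin J.s → ℕ → Fin n → ℂ}
    (h : kronSum J x = kronSum J y) (i : Fin J.s) {k : ℕ} (hk : k < J.α i) : x i k = y i k := by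
  ext a
  have key : ∀ z : Fin J.s → ℕ → Fin n → ℂ,
      J.basis.repr (fun r => kronSum J z (r, a)) ⟨i, ⟨k, hk⟩⟩ = z i k a := by
    intro z
    rw [kronSum_column, Module.Basis.repr_sum_self]
  rw [← key x, ← key y, h]

lemma exists_kronSum_eq (J : JordanChains M) (X : Fin N × Fin n → ℂ) :
    ∃ x : Fin J.s → ℕ → Fin n → ℂ, (∀ i k, J.α i ≤ k → x i k = 0) ∧ kronSum J x = X := by
  refine ⟨fun i k a => if h : k < J.α i then
    J.basis.repr (fun r => X (r, a)) ⟨i, ⟨k, h⟩⟩ else 0, ?_, ?_⟩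
  · intro i k hk
    ext a
    simp [not_lt.2 hk]
  · ext ⟨r, a⟩
    have := congrFun (kronSum_column J (fun i k a => if h : k < J.α i then
      J.basis.repr (fun r => X (r, a)) ⟨i, ⟨k, h⟩⟩ else 0) a) r
    simp only [Fin.is_lt, dite_true, Fin.eta, Sigma.eta] at this
    rw [this, J.basis.sum_repr]

lemma kronSum_smul (J : JordanChains M) (c : ℂ) (x : Fin J.s → ℕ → Fin n → ℂ) :
    kronSum J (fun i k => c • x i k) = c • kronSum J x := by
  simp [kronSum, kronVec_eq_kronVecLin, Finset.smul_sum]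

/-- The nilpotent part of `M` moves `H x_i^{k+1}` from `t_i^{k+1}` to `t_i^k`. Vanishing of `x` from
index `α i` on makes the formula valid at the last vector of each chain too. -/
lemma kronecker_mulVec_kronSum (J : JordanChains M) (A H : Matrix (Fin n) (Fin n) ℂ)
    {x : Fin J.s → ℕ → Fin n → ℂ} (hx : ∀ i k, J.α i ≤ k → x i k = 0) :
    ((1 : Matrix (Fin N) (Fin N) ℂ) ⊗ₖ A + M ⊗ₖ H) *ᵥ kronSum J x =
      kronSum J (fun i k => (A + J.eigval i • H) *ᵥ x i k + H *ᵥ x i (k + 1)) := by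
  simp only [kronSum, Matrix.mulVec_sum]
  refine Finset.sum_congr rfl fun i _ => ?_
  obtain ⟨a, ha⟩ : ∃ a, J.α i = a + 1 := ⟨J.α i - 1, by have := J.one_le_α i; omega⟩
  have hlast : x i (a + 1) = 0 := hx i _ ha.le
  have hshift : ∑ k ∈ Finset.range (a + 1), kronVec (M *ᵥ J.t i k) (H *ᵥ x i k) =
      ∑ k ∈ Finset.range (a + 1), kronVec (J.t i k) (J.eigval i • H *ᵥ x i k) +
      ∑ k ∈ Finset.range (a + 1), kronVec (J.t i k) (H *ᵥ x i (k + 1)) := by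
    rw [Finset.sum_range_succ', Finset.sum_range_succ', Finset.sum_range_succ _ a, hlast,
      J.top_vec, kronVec_smul_left]
    have : ∀ k ∈ Finset.range a, kronVec (M *ᵥ J.t i (k + 1)) (H *ᵥ x i (k + 1)) =
        kronVec (J.t i (k + 1)) (J.eigval i • H *ᵥ x i (k + 1)) +
          kronVec (J.t i k) (H *ᵥ x i (k + 1)) := by
      intro k hk
      rw [J.succ_vec i k (by have := Finset.mem_range.1 hk; omega), kronVec_add_left,
        kronVec_smul_left]
    rw [Finset.sum_congr rfl this, Finset.sum_add_distrib]
    simp only [kronVec_eq_kronVecLin, Matrix.mulVec_zero, map_zero]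
    abel
  rw [ha]
  simp only [Matrix.add_mulVec, kronecker_mulVec_kronVec, Matrix.one_mulVec, Matrix.smul_mulVec]
  rw [Finset.sum_add_distrib, hshift, ← Finset.sum_add_distrib, ← Finset.sum_add_distrib]
  refine Finset.sum_congr rfl fun k _ => ?_
  simp only [kronVec_eq_kronVecLin, map_add]
  abel

lemma mem_eigenspace_iff_mulVec {ι : Type*} [Fintype ι] [DecidableEq ι] (P : Matrix ι ι ℂ) (μ : ℂ)
    (X : ι → ℂ) : X ∈ eigenspace P μ ↔ P *ᵥ X = μ • X := by
  rw [eigenspace, Module.End.mem_eigenspace_iff, Matrix.toLin'_apply]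

lemma kronSum_mem_eigenspace_iff (J : JordanChains M) (A H : Matrix (Fin n) (Fin n) ℂ)
    {x : Fin J.s → ℕ → Fin n → ℂ} (hx : ∀ i k, J.α i ≤ k → x i k = 0) (μ : ℂ) :
    kronSum J x ∈ eigenspace ((1 : Matrix (Fin N) (Fin N) ℂ) ⊗ₖ A + M ⊗ₖ H) μ ↔
      ∀ i k, (μ • (1 : Matrix (Fin n) (Fin n) ℂ) - (A + J.eigval i • H)) *ᵥ x i k =
        H *ᵥ x i (k + 1) := by
  rw [mem_eigenspace_iff_mulVec, kronecker_mulVec_kronSum J A H hx, ← kronSum_smul]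
  have hiff : ∀ i k, (μ • (1 : Matrix (Fin n) (Fin n) ℂ) - (A + J.eigval i • H)) *ᵥ x i k =
        H *ᵥ x i (k + 1) ↔
      (A + J.eigval i • H) *ᵥ x i k + H *ᵥ x i (k + 1) = μ • x i k := by
    intro i k
    rw [Matrix.sub_mulVec, Matrix.smul_mulVec, Matrix.one_mulVec, sub_eq_iff_eq_add, eq_comm,
      add_comm]
  refine ⟨fun h i k => ?_, fun h => ?_⟩
  · rcases lt_or_ge k (J.α i) with hk | hk
    · exact (hiff i k).2 (kronSum_inj J h i hk)
    · rw [hx i k hk, hx i (k + 1) (by omega), Matrix.mulVec_zero, Matrix.mulVec_zero]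
  · exact congrArg _ (funext₂ fun i k => (hiff i k).1 (h i k))

end KronSum

/-! ### The vectors `η_ij^m`: reversed chains and linear independence -/

section Eta

variable {N n : ℕ} {M : Matrix (Fin N) (Fin N) ℂ}

/-- The finite sequence `ξ 0, …, ξ m` in reverse order, continued by `0`. -/
def revSeq (ξ : ℕ → Fin n → ℂ) (m k : ℕ) : Fin n → ℂ := if k ≤ m then ξ (m - k) else 0

lemma eta_eq_sum (t : ℕ → Fin N → ℂ) (ξ : ℕ → Fin n → ℂ) {m a : ℕ} (hm : m < a) :
    eta t ξ m = ∑ k ∈ Finset.range a, kronVec (t k) (revSeq ξ m k) := by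
  rw [eta, ← Finset.sum_range_reflect]
  rw [← Finset.sum_subset (Finset.range_mono (show m + 1 ≤ a from hm))]
  · refine Finset.sum_congr rfl fun k hk => ?_
    have := Finset.mem_range.1 hk
    rw [revSeq, if_pos (by omega)]
    congr 2; omega
  · intro k _ hk
    rw [revSeq, if_neg (by simpa using hk), kronVec_eq_kronVecLin, map_zero]

lemma sum_eq_kronSum_single (J : JordanChains M) (i : Fin J.s) (y : ℕ → Fin n → ℂ) :
    ∑ k ∈ Finset.range (J.α i), kronVec (J.t i k) (y k) =
      kronSum J (fun i' k => if i' = i then y k else 0) := by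
  rw [kronSum, Finset.sum_eq_single i]
  · simp
  · intro i' _ hi
    simp [hi, kronVec_eq_kronVecLin]
  · simp

lemma revSeq_chain {P H : Matrix (Fin n) (Fin n) ℂ} {μ : ℂ} {θ : ℕ∞} {ξ : ℕ → Fin n → ℂ}
    (h : IsGenJordanChain P H μ θ ξ) {m : ℕ} (hm : (m : ℕ∞) < θ) (k : ℕ) :
    (μ • (1 : Matrix (Fin n) (Fin n) ℂ) - P) *ᵥ revSeq ξ m k = H *ᵥ revSeq ξ m (k + 1) := by
  rcases lt_trichotomy k m with hk | rfl | hk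
  · rw [revSeq, revSeq, if_pos hk.le, if_pos (show k + 1 ≤ m from hk),
      show m - k = (m - (k + 1)) + 1 by omega]
    refine h.succ_vec _ (lt_of_le_of_lt ?_ hm)
    exact_mod_cast (by omega : m - (k + 1) + 1 ≤ m)
  · simp [revSeq, h.top_vec]
  · simp [revSeq, not_le.2 hk, show ¬ k + 1 ≤ m by omega]

/-- All the `η_ij^m` with `1 ≤ m ≤ α_i` are linearly independent. -/
lemma linearIndependent_eta (J : JordanChains M) {p : Fin J.s → ℕ}
    (ξ : ∀ i, Fin (p i) → ℕ → Fin n → ℂ) (hξ : ∀ i, LinearIndependent ℂ (fun j => ξ i j 0)) :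
    LinearIndependent ℂ (fun r : (Σ q : (Σ i : Fin J.s, Fin (p i)), Fin (J.α q.1)) =>
      eta (J.t r.1.1) (ξ r.1.1 r.1.2) r.2) := by
  rw [Fintype.linearIndependent_iff]
  intro g hg
  have hsum : kronSum J (fun i k => ∑ j, ∑ m : Fin (J.α i), g ⟨⟨i, j⟩, m⟩ • revSeq (ξ i j) m k) =
      kronSum J (fun _ _ => 0) := by
    have h0 : kronSum J (fun _ _ => (0 : Fin n → ℂ)) = 0 := by
      simp [kronSum, kronVec_eq_kronVecLin]
    rw [h0, ← hg, Fintype.sum_sigma, Fintype.sum_sigma, kronSum]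
    refine Finset.sum_congr rfl fun i _ => ?_
    simp only [kronVec_eq_kronVecLin, map_sum, map_smul]
    rw [Finset.sum_comm]
    refine Finset.sum_congr rfl fun j _ => ?_
    rw [Finset.sum_comm]
    refine Finset.sum_congr rfl fun m _ => ?_
    rw [← Finset.smul_sum, eta_eq_sum _ _ m.2]
    rfl
  have hz : ∀ i k, k < J.α i →
      ∑ j, ∑ m : Fin (J.α i), g ⟨⟨i, j⟩, m⟩ • revSeq (ξ i j) m k = 0 :=
    fun i k hk => kronSum_inj J hsum i hk
  -- Descending induction on `m`, with `d` bounding the distance to the end of the chain. At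
  -- `t_i^m`, terms with `m' < m` vanish by `revSeq` and those with `m' > m` by induction, leaving a
  -- relation between top vectors. Entries of `ξ` beyond `θ` therefore do no harm.
  have key : ∀ i (d : ℕ) (m : Fin (J.α i)), J.α i ≤ m + 1 + d → ∀ j, g ⟨⟨i, j⟩, m⟩ = 0 := by
    intro i d
    induction d using Nat.strong_induction_on with
    | _ d ih =>
      intro m hm
      refine Fintype.linearIndependent_iff.1 (hξ i) (fun j => g ⟨⟨i, j⟩, m⟩) ?_
      rw [← hz i m m.2]
      refine Finset.sum_congr rfl fun j _ => ?_
      rw [Finset.sum_eq_single m]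
      · simp [revSeq]
      · intro m' _ hne
        rcases lt_or_gt_of_ne hne with hlt | hgt
        · rw [revSeq, if_neg (not_le.2 (Fin.lt_def.1 hlt)), smul_zero]
        · have : (m : ℕ) < m' := hgt
          have := m'.2
          rw [ih (J.α i - (m' + 1)) (by omega) m' (by omega) j, zero_smul]
      · simp
  rintro ⟨⟨i, j⟩, m⟩
  exact key i (J.α i) m (by omega) j

end Eta

/-! ### The eigenspaces of the network as direct sums of the `V_ij` -/

section Eigenspaces

variable {N n : ℕ} {A H : Matrix (Fin n) (Fin n) ℝ} {L : Matrix (Fin N) (Fin N) ℝ}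

lemma toC_stateMatrix (A H : Matrix (Fin n) (Fin n) ℝ) (L : Matrix (Fin N) (Fin N) ℝ) :
    toC (stateMatrix A H L) = (1 : Matrix (Fin N) (Fin N) ℂ) ⊗ₖ toC A + toC L ⊗ₖ toC H := by
  ext ⟨r, a⟩ ⟨r', a'⟩
  simp [toC, stateMatrix, Matrix.one_apply, apply_ite Complex.ofReal]

/-- Different `V_ij` are contained in spans of disjoint parts of one linearly independent family,
whatever their eigenvalues `μ_i^j`. -/
theorem iSupIndep_V (J : JordanChains (toC L))
    (G : ∀ i : Fin J.s, GenJordanChains (toC A + J.eigval i • toC H) (toC H)) :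
    iSupIndep (V J G) := by
  set f : (Σ q : (Σ i : Fin J.s, Fin (G i).p), Fin (J.α q.1)) → Fin N × Fin n → ℂ :=
    fun r => eta (J.t r.1.1) ((G r.1.1).ξ r.1.2) r.2 with hf
  have hli : LinearIndependent ℂ f :=
    linearIndependent_eta J (fun i => (G i).ξ) (fun i => (G i).linearIndependent)
  have hV : ∀ q, V J G q ≤ Submodule.span ℂ (f '' {r | r.1 = q}) := by
    intro q
    refine Submodule.span_mono ?_
    rintro v ⟨m, hm, rfl⟩
    exact ⟨⟨q, ⟨m, by exact_mod_cast (lt_min_iff.1 hm).1⟩⟩, rfl, rfl⟩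
  intro q
  refine (hli.disjoint_span_image (s := {r | r.1 = q}) (t := {r | r.1 ≠ q}) ?_).mono (hV q) ?_
  · exact Set.disjoint_left.2 fun r h h' => h' h
  · refine iSup₂_le fun q' hq' => (hV q').trans (Submodule.span_mono (Set.image_mono ?_))
    rintro r rfl
    exact hq'

lemma eta_mem_eigenspace (J : JordanChains (toC L))
    (G : ∀ i : Fin J.s, GenJordanChains (toC A + J.eigval i • toC H) (toC H))
    (i : Fin J.s) (j : Fin (G i).p) {m : ℕ} (hm : (m : ℕ∞) < min (J.α i : ℕ∞) ((G i).θ j)) :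
    eta (J.t i) ((G i).ξ j) m ∈ eigenspace (toC (stateMatrix A H L)) ((G i).eigval j) := by
  have hmα : m < J.α i := by exact_mod_cast (lt_min_iff.1 hm).1
  rw [toC_stateMatrix, eta_eq_sum _ _ hmα, sum_eq_kronSum_single, kronSum_mem_eigenspace_iff]
  · intro i' k
    by_cases h : i' = i
    · subst h
      simpa using revSeq_chain ((G i').isChain j) (lt_min_iff.1 hm).2 k
    · simp [h]
  · intro i' k hk
    by_cases h : i' = i
    · subst h
      simp [revSeq, show ¬ k ≤ m by omega]
    · simp [h]

/-- Induction on the bound `m` for the support of `x`: subtracting a combination of reversed listed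
chains cancels the last term and preserves the chain equations. -/
lemma sum_kronVec_mem_sumV (J : JordanChains (toC L))
    (G : ∀ i : Fin J.s, GenJordanChains (toC A + J.eigval i • toC H) (toC H)) (μ : ℂ)
    (i : Fin J.s) {m : ℕ} (hm : m ≤ J.α i) (x : ℕ → Fin n → ℂ) (hx : ∀ k, m ≤ k → x k = 0)
    (hchain : ∀ k, (μ • (1 : Matrix (Fin n) (Fin n) ℂ) - (toC A + J.eigval i • toC H)) *ᵥ x k =
      toC H *ᵥ x (k + 1)) :
    ∑ k ∈ Finset.range (J.α i), kronVec (J.t i k) (x k) ∈ sumV J G μ := by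
  induction m generalizing x with
  | zero => simp [hx, kronVec_eq_kronVecLin]
  | succ m ih =>
    by_cases h0 : x m = 0
    · refine ih (by omega) x (fun k hk => ?_) hchain
      rcases hk.eq_or_lt with rfl | hk
      exacts [h0, hx k hk]
    -- Reversal makes the last nonzero term the top vector of a chain of length `m + 1`, to which
    -- maximality applies.
    have hcx : IsGenJordanChain (toC A + J.eigval i • toC H) (toC H) μ ((m + 1 : ℕ) : ℕ∞)
        (fun k => x (m - k)) := by
      refine ⟨by exact_mod_cast (by omega : 1 ≤ m + 1), h0, ?_, fun k hk => ?_⟩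
      · rw [Nat.sub_zero, hchain, hx _ le_rfl, Matrix.mulVec_zero]
      · have : k + 1 < m + 1 := by exact_mod_cast hk
        rw [hchain, show m - (k + 1) + 1 = m - k by omega]
    have hspan := (G i).maximal μ (m + 1) _ hcx
    rw [Nat.sub_zero] at hspan
    have hz : ∃ z : ℕ → Fin n → ℂ, z m = x m ∧ (∀ k, m + 1 ≤ k → z k = 0) ∧
        (∀ k, (μ • (1 : Matrix (Fin n) (Fin n) ℂ) - (toC A + J.eigval i • toC H)) *ᵥ z k =
          toC H *ᵥ z (k + 1)) ∧
        ∑ k ∈ Finset.range (J.α i), kronVec (J.t i k) (z k) ∈ sumV J G μ := by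
      -- The claim is now closed under linear combinations in `v`, so it reduces to listed top
      -- vectors, where `z` is the reversed listed chain.
      generalize x m = v at hspan
      induction hspan using Submodule.span_induction with
      | mem v hv =>
        obtain ⟨j, hj, hθ, rfl⟩ := hv
        have hmθ : (m : ℕ∞) < (G i).θ j :=
          lt_of_lt_of_le (by exact_mod_cast Nat.lt_succ_self m) hθ
        refine ⟨revSeq ((G i).ξ j) m, by simp [revSeq], fun k hk => ?_, fun k => ?_, ?_⟩
        · rw [revSeq, if_neg (by omega)]
        · rw [← hj]
          exact revSeq_chain ((G i).isChain j) hmθ k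
        · rw [← eta_eq_sum _ _ (by omega)]
          refine Submodule.mem_iSup_of_mem (⟨⟨i, j⟩, hj⟩ : Gam J G μ) (Submodule.subset_span ?_)
          exact ⟨m, lt_min (by exact_mod_cast hm) hmθ, rfl⟩
      | zero => exact ⟨fun _ => 0, rfl, by simp, by simp, by simp [kronVec_eq_kronVecLin]⟩
      | add v w _ _ hv hw =>
        obtain ⟨y, rfl, hy, hy', hys⟩ := hv
        obtain ⟨z, rfl, hz, hz', hzs⟩ := hw
        refine ⟨y + z, rfl, fun k hk => by simp [hy k hk, hz k hk],
          fun k => by simp [Matrix.mulVec_add, hy', hz'], ?_⟩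
        simpa [kronVec_eq_kronVecLin, Finset.sum_add_distrib] using add_mem hys hzs
      | smul c v _ hv =>
        obtain ⟨y, rfl, hy, hy', hys⟩ := hv
        refine ⟨c • y, rfl, fun k hk => by simp [hy k hk],
          fun k => by simp [Matrix.mulVec_smul, hy'], ?_⟩
        simpa [kronVec_eq_kronVecLin, Finset.smul_sum] using Submodule.smul_mem _ c hys
    obtain ⟨z, hzm, hz0, hzc, hzs⟩ := hz
    have hdiff := ih (by omega) (x - z) (fun k hk => ?_) (fun k => ?_)
    · simpa [kronVec_eq_kronVecLin, Finset.sum_sub_distrib] using add_mem hdiff hzs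
    · rcases hk.eq_or_lt with rfl | hk
      · simp [hzm]
      · simp [hx k hk, hz0 k hk]
    · simp only [Pi.sub_apply, Matrix.mulVec_sub, hchain, hzc]

theorem eigenspace_stateMatrix_eq_sumV (J : JordanChains (toC L))
    (G : ∀ i : Fin J.s, GenJordanChains (toC A + J.eigval i • toC H) (toC H)) (μ : ℂ) :
    eigenspace (toC (stateMatrix A H L)) μ = sumV J G μ := by
  refine le_antisymm (fun X hX => ?_) (iSup_le ?_)
  · obtain ⟨x, hx, rfl⟩ := exists_kronSum_eq J X
    rw [toC_stateMatrix, kronSum_mem_eigenspace_iff J _ _ hx] at hX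
    exact Submodule.sum_mem _ fun i _ =>
      sum_kronVec_mem_sumV J G μ i le_rfl (x i) (hx i) (hX i)
  · rintro ⟨⟨i, j⟩, rfl⟩
    refine Submodule.span_le.2 ?_
    rintro v ⟨m, hm, rfl⟩
    exact eta_mem_eigenspace J G i j hm

end Eigenspaces


/-! ### Discernibility as an eigenvector test -/

section Discernibility

variable {ι κ : Type*} [Fintype ι]

lemma toC_mulVec_re (P : Matrix κ ι ℝ) (x : ι → ℂ) (i : κ) :
    ((toC P *ᵥ x) i).re = (P *ᵥ fun j => (x j).re) i := by
  simp [toC, Matrix.mulVec, dotProduct]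

lemma toC_mulVec_im (P : Matrix κ ι ℝ) (x : ι → ℂ) (i : κ) :
    ((toC P *ᵥ x) i).im = (P *ᵥ fun j => (x j).im) i := by
  simp [toC, Matrix.mulVec, dotProduct]

lemma toC_mulVec_ofReal (P : Matrix κ ι ℝ) (X : ι → ℝ) :
    (toC P *ᵥ fun j => (X j : ℂ)) = fun i => ((P *ᵥ X) i : ℂ) := by
  ext i
  simp [toC, Matrix.mulVec, dotProduct]

variable [DecidableEq ι]

lemma toC_pow (P : Matrix ι ι ℝ) (k : ℕ) : toC (P ^ k) = toC P ^ k :=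
  map_pow Complex.ofRealHom.mapMatrix P k

lemma pow_mulVec_of_eigen {P : Matrix ι ι ℂ} {μ : ℂ} {x : ι → ℂ} (h : P *ᵥ x = μ • x) (k : ℕ) :
    P ^ k *ᵥ x = μ ^ k • x := by
  induction k with
  | zero => simp
  | succ k ih => rw [pow_succ, ← Matrix.mulVec_mulVec, h, Matrix.mulVec_smul, ih, smul_smul,
      pow_succ']

/-- The linear map `P ↦ Ψ P X` on square matrices. -/
def outputLin (Ψ : Matrix κ ι ℝ) (X : ι → ℝ) : Matrix ι ι ℝ →ₗ[ℝ] (κ → ℝ) where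
  toFun P := Ψ *ᵥ (P *ᵥ X)
  map_add' P Q := by rw [Matrix.add_mulVec, Matrix.mulVec_add]
  map_smul' c P := by rw [Matrix.smul_mulVec, Matrix.mulVec_smul, RingHom.id_apply]

attribute [local instance] Matrix.linftyOpNormedRing Matrix.linftyOpNormedAlgebra

lemma hasSum_output (Φ : Matrix ι ι ℝ) (Ψ : Matrix κ ι ℝ) (X : ι → ℝ) (t : ℝ) :
    HasSum (fun k : ℕ => ((k.factorial : ℝ)⁻¹ * t ^ k) • (Ψ *ᵥ (Φ ^ k *ᵥ X)))
      (Ψ *ᵥ (NormedSpace.exp (t • Φ) *ᵥ X)) := by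
  have h := (NormedSpace.exp_series_hasSum_exp' (𝕂 := ℝ) (t • Φ)).map (outputLin Ψ X)
    (outputLin Ψ X).continuous_of_finiteDimensional
  convert h using 1
  · ext1 k
    rw [Function.comp_apply, smul_pow, smul_smul, map_smul]
    rfl
  · rfl

lemma hasDerivAt_output [Fintype κ] (Φ : Matrix ι ι ℝ) (Ψ : Matrix κ ι ℝ) (X : ι → ℝ) (t : ℝ) :
    HasDerivAt (fun u : ℝ => Ψ *ᵥ (NormedSpace.exp (u • Φ) *ᵥ X))
      (Ψ *ᵥ (NormedSpace.exp (t • Φ) *ᵥ (Φ *ᵥ X))) t := by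
  have h := (outputLin Ψ X).toContinuousLinearMap.hasFDerivAt.comp_hasDerivAt t
    (hasDerivAt_exp_smul_const (𝕂 := ℝ) Φ t)
  exact h.congr_deriv
    (congrArg (Ψ *ᵥ ·) (Matrix.mulVec_mulVec X (NormedSpace.exp (t • Φ)) Φ).symm)

/-- Differentiate the equality of outputs. It is known only for `t ≥ 0`, so derivatives are taken
within `[0, ∞)`, where they are unique even at `0`. -/
lemma IsIndiscerniblePair.mulVec [Fintype κ] {Φ Φ' : Matrix ι ι ℝ} {Ψ : Matrix κ ι ℝ}
    {X X' : ι → ℝ} (h : IsIndiscerniblePair Φ Φ' Ψ X X') :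
    IsIndiscerniblePair Φ Φ' Ψ (Φ *ᵥ X) (Φ' *ᵥ X') := by
  intro t ht
  have h₁ := (hasDerivAt_output Φ Ψ X t).hasDerivWithinAt (s := Set.Ici 0)
  have h₂ := ((hasDerivAt_output Φ' Ψ X' t).hasDerivWithinAt (s := Set.Ici 0)).congr
    (fun u hu => h u hu) (h t ht)
  exact (uniqueDiffOn_Ici (0 : ℝ) t ht).eq_deriv _ h₁ h₂

/-- A pair is indiscernible if and only if all derivatives of the outputs at `0` agree. -/
theorem isIndiscerniblePair_iff_pow [Fintype κ] (Φ Φ' : Matrix ι ι ℝ) (Ψ : Matrix κ ι ℝ)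
    (X X' : ι → ℝ) :
    IsIndiscerniblePair Φ Φ' Ψ X X' ↔ ∀ k : ℕ, Ψ *ᵥ (Φ ^ k *ᵥ X) = Ψ *ᵥ (Φ' ^ k *ᵥ X') := by
  refine ⟨fun h k => ?_, fun h t _ => ?_⟩
  · have hk : IsIndiscerniblePair Φ Φ' Ψ (Φ ^ k *ᵥ X) (Φ' ^ k *ᵥ X') := by
      induction k with
      | zero => simpa using h
      | succ k ih => simpa only [pow_succ', Matrix.mulVec_mulVec] using ih.mulVec
    simpa using hk 0 le_rfl
  · refine (hasSum_output Φ Ψ X t).unique ?_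
    simpa only [h] using hasSum_output Φ' Ψ X' t

/-- The pairs of complex initial states with the same output derivatives of all orders. -/
noncomputable def unobservable (Φ Φ' : Matrix ι ι ℂ) (Ψ : Matrix κ ι ℂ) :
    Submodule ℂ ((ι → ℂ) × (ι → ℂ)) :=
  ⨅ k : ℕ, LinearMap.eqLocus
    (((Ψ * Φ ^ k).mulVecLin) ∘ₗ LinearMap.fst ℂ (ι → ℂ) (ι → ℂ))
    (((Ψ * Φ' ^ k).mulVecLin) ∘ₗ LinearMap.snd ℂ (ι → ℂ) (ι → ℂ))

lemma mem_unobservable {Φ Φ' : Matrix ι ι ℂ} {Ψ : Matrix κ ι ℂ} {z : (ι → ℂ) × (ι → ℂ)} :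
    z ∈ unobservable Φ Φ' Ψ ↔ ∀ k : ℕ, Ψ *ᵥ (Φ ^ k *ᵥ z.1) = Ψ *ᵥ (Φ' ^ k *ᵥ z.2) := by
  simp [unobservable, Submodule.mem_iInf, LinearMap.mem_eqLocus, Matrix.mulVec_mulVec]

/-- The eigenvector test for the pair of systems. -/
theorem unobservable_eq_bot {Φ Φ' : Matrix ι ι ℂ} {Ψ : Matrix κ ι ℂ}
    (h : ∀ (μ : ℂ) (x x' : ι → ℂ), Φ *ᵥ x = μ • x → Φ' *ᵥ x' = μ • x' → Ψ *ᵥ x = Ψ *ᵥ x' →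
      x = 0 ∧ x' = 0) : unobservable Φ Φ' Ψ = ⊥ := by
  by_contra hne
  have : Nontrivial (unobservable Φ Φ' Ψ) := Submodule.nontrivial_iff_ne_bot.2 hne
  -- Applying `Φ × Φ'` shifts the sequence of output derivatives by one.
  have hmaps : ∀ z ∈ unobservable Φ Φ' Ψ,
      (Φ.mulVecLin.prodMap Φ'.mulVecLin) z ∈ unobservable Φ Φ' Ψ := by
    intro z hz
    rw [mem_unobservable] at hz ⊢
    intro k
    simpa [pow_succ, Matrix.mulVec_mulVec] using hz (k + 1)
  obtain ⟨μ, hμ⟩ := Module.End.exists_eigenvalue ((Φ.mulVecLin.prodMap Φ'.mulVecLin).restrict hmaps)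
  obtain ⟨⟨⟨x, x'⟩, hz⟩, hv⟩ := hμ.exists_hasEigenvector
  have heq := congrArg Subtype.val hv.apply_eq_smul
  have h₁ : Φ *ᵥ x = μ • x := congrArg Prod.fst heq
  have h₂ : Φ' *ᵥ x' = μ • x' := congrArg Prod.snd heq
  obtain ⟨rfl, rfl⟩ := h μ x x' h₁ h₂ (by simpa using mem_unobservable.1 hz 0)
  exact hv.2 rfl

/-- Discernibility concerns real states, eigenvectors are complex. The real and imaginary parts of a
complex pair with equal output derivatives are indiscernible real pairs; conversely a real pair is
viewed as a complex one. -/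
theorem isDiscernible_iff_eigenvectors [Fintype κ] (Φ Φ' : Matrix ι ι ℝ) (Ψ : Matrix κ ι ℝ) :
    IsDiscernible Φ Φ' Ψ ↔ ∀ (μ : ℂ) (x x' : ι → ℂ), toC Φ *ᵥ x = μ • x → toC Φ' *ᵥ x' = μ • x' →
      toC Ψ *ᵥ x = toC Ψ *ᵥ x' → x = 0 ∧ x' = 0 := by
  refine ⟨fun h μ x x' hx hx' hΨ => ?_, fun h X X' hX => ?_⟩
  · have hpow : ∀ k : ℕ, toC Ψ *ᵥ (toC (Φ ^ k) *ᵥ x) = toC Ψ *ᵥ (toC (Φ' ^ k) *ᵥ x') := by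
      intro k
      rw [toC_pow, toC_pow, pow_mulVec_of_eigen hx, pow_mulVec_of_eigen hx', Matrix.mulVec_smul,
        Matrix.mulVec_smul, hΨ]
    have hre := h (fun j => (x j).re) (fun j => (x' j).re)
      ((isIndiscerniblePair_iff_pow _ _ _ _ _).2 fun k => by
        ext i
        simpa only [toC_mulVec_re] using congrArg Complex.re (congrFun (hpow k) i))
    have him := h (fun j => (x j).im) (fun j => (x' j).im)
      ((isIndiscerniblePair_iff_pow _ _ _ _ _).2 fun k => by
        ext i
        simpa only [toC_mulVec_im] using congrArg Complex.im (congrFun (hpow k) i))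
    exact ⟨funext fun j => Complex.ext (congrFun hre.1 j) (congrFun him.1 j),
      funext fun j => Complex.ext (congrFun hre.2 j) (congrFun him.2 j)⟩
  · rw [isIndiscerniblePair_iff_pow] at hX
    have hmem : ((fun j => (X j : ℂ), fun j => (X' j : ℂ)) : (ι → ℂ) × (ι → ℂ)) ∈
        unobservable (toC Φ) (toC Φ') (toC Ψ) := by
      rw [mem_unobservable]
      intro k
      simp only [← toC_pow, toC_mulVec_ofReal, hX k]
    rw [unobservable_eq_bot h, Submodule.mem_bot, Prod.mk_eq_zero] at hmem
    exact ⟨funext fun j => Complex.ofReal_eq_zero.1 (congrFun hmem.1 j),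
      funext fun j => Complex.ofReal_eq_zero.1 (congrFun hmem.2 j)⟩

lemma eigenspace_eq_bot_of_notMem {P : Matrix ι ι ℂ} {μ : ℂ} (h : μ ∉ eigenvalues P) :
    eigenspace P μ = ⊥ :=
  not_not.1 h

theorem isDiscernible_iff_eigenspaces [Fintype κ] (Φ Φ' : Matrix ι ι ℝ) (Ψ : Matrix κ ι ℝ) :
    IsDiscernible Φ Φ' Ψ ↔ ∀ μ ∈ eigenvalues (toC Φ) ∪ eigenvalues (toC Φ'),
      eigenspace (toC Φ) μ ⊓ eigenspace (toC Φ') μ = ⊥ ∧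
      nullSpace (toC Ψ) ⊓ (eigenspace (toC Φ) μ ⊔ eigenspace (toC Φ') μ) = ⊥ := by
  rw [isDiscernible_iff_eigenvectors]
  simp only [← mem_eigenspace_iff_mulVec]
  refine ⟨fun h μ _ => ⟨?_, ?_⟩, fun h μ x x' hx hx' hΨ => ?_⟩
  · rw [Submodule.eq_bot_iff]
    exact fun z hz => (h μ z z hz.1 hz.2 rfl).1
  · rw [Submodule.eq_bot_iff]
    rintro z ⟨hz, hz'⟩
    obtain ⟨x, hx, y, hy, rfl⟩ := Submodule.mem_sup.1 hz'
    have hxy : toC Ψ *ᵥ (x + y) = 0 := hz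
    rw [Matrix.mulVec_add] at hxy
    -- A null vector `x + y` of `Ψ` corresponds to the pair `(x, -y)` with equal outputs.
    obtain ⟨h₁, h₂⟩ := h μ x (-y) hx (neg_mem hy)
      (by rw [Matrix.mulVec_neg]; exact eq_neg_of_add_eq_zero_left hxy)
    rw [h₁, neg_eq_zero.1 h₂, add_zero]
  · by_cases hμ : μ ∈ eigenvalues (toC Φ) ∪ eigenvalues (toC Φ')
    · obtain ⟨h₁, h₂⟩ := h μ hμ
      have hsub : x - x' ∈ nullSpace (toC Ψ) ⊓ (eigenspace (toC Φ) μ ⊔ eigenspace (toC Φ') μ) := by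
        refine ⟨?_, sub_mem (Submodule.mem_sup_left hx) (Submodule.mem_sup_right hx')⟩
        change toC Ψ *ᵥ (x - x') = 0
        rw [Matrix.mulVec_sub, hΨ, sub_self]
      rw [h₂, Submodule.mem_bot, sub_eq_zero] at hsub
      subst hsub
      have : x ∈ eigenspace (toC Φ) μ ⊓ eigenspace (toC Φ') μ := ⟨hx, hx'⟩
      rw [h₁, Submodule.mem_bot] at this
      exact ⟨this, this⟩
    · rw [Set.mem_union, not_or] at hμ
      rw [eigenspace_eq_bot_of_notMem hμ.1] at hx
      rw [eigenspace_eq_bot_of_notMem hμ.2] at hx'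
      exact ⟨hx, hx'⟩

end Discernibility

end NetworkedLTI

theorem mainTheorem4 {N n p : ℕ}
    (A H : Matrix (Fin n) (Fin n) ℝ) (C : Matrix (Fin p) (Fin n) ℝ) (S : Finset (Fin N))
    (L L' : Matrix (Fin N) (Fin N) ℝ)
    (J : NetworkedLTI.JordanChains (NetworkedLTI.toC L))
    (J' : NetworkedLTI.JordanChains (NetworkedLTI.toC L'))
    (G : ∀ i : Fin J.s, NetworkedLTI.GenJordanChains
      (NetworkedLTI.toC A + J.eigval i • NetworkedLTI.toC H) (NetworkedLTI.toC H))
    (G' : ∀ i : Fin J'.s, NetworkedLTI.GenJordanChains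
      (NetworkedLTI.toC A + J'.eigval i • NetworkedLTI.toC H) (NetworkedLTI.toC H)) :
    -- the sums of the `V_ij` are direct and equal to the eigenspaces of `Φ`, `Φ'`
    (∀ μ : ℂ, iSupIndep (fun q : NetworkedLTI.Gam J G μ => NetworkedLTI.V J G q.1) ∧
      NetworkedLTI.eigenspace (NetworkedLTI.toC (NetworkedLTI.stateMatrix A H L)) μ =
        NetworkedLTI.sumV J G μ) ∧
    (∀ μ : ℂ, iSupIndep (fun q : NetworkedLTI.Gam J' G' μ => NetworkedLTI.V J' G' q.1) ∧
      NetworkedLTI.eigenspace (NetworkedLTI.toC (NetworkedLTI.stateMatrix A H L')) μ =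
        NetworkedLTI.sumV J' G' μ) ∧
    -- the criterion
    (NetworkedLTI.IsDiscernible (NetworkedLTI.stateMatrix A H L) (NetworkedLTI.stateMatrix A H L')
        (NetworkedLTI.outputMatrix S C) ↔
      ∀ μ ∈ NetworkedLTI.eigenvalues (NetworkedLTI.toC (NetworkedLTI.stateMatrix A H L)) ∪
          NetworkedLTI.eigenvalues (NetworkedLTI.toC (NetworkedLTI.stateMatrix A H L')),
        NetworkedLTI.sumV J G μ ⊓ NetworkedLTI.sumV J' G' μ = ⊥ ∧
        NetworkedLTI.nullSpace (NetworkedLTI.toC (NetworkedLTI.outputMatrix S C)) ⊓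
          (NetworkedLTI.sumV J G μ ⊔ NetworkedLTI.sumV J' G' μ) = ⊥) := by
  refine ⟨fun μ => ⟨(NetworkedLTI.iSupIndep_V J G).comp Subtype.val_injective,
      NetworkedLTI.eigenspace_stateMatrix_eq_sumV J G μ⟩,
    fun μ => ⟨(NetworkedLTI.iSupIndep_V J' G').comp Subtype.val_injective,
      NetworkedLTI.eigenspace_stateMatrix_eq_sumV J' G' μ⟩, ?_⟩
  rw [NetworkedLTI.isDiscernible_iff_eigenspaces]
  simp only [NetworkedLTI.eigenspace_stateMatrix_eq_sumV J G,
    NetworkedLTI.eigenspace_stateMatrix_eq_sumV J' G']
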